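/- Let $\Gamma$ be a finite simple graph with $V=|V(\Gamma)|$ vertices, and let $A(\Gamma)=\langle\, v\in V(\Gamma)\mid vw=wv \text{ whenever } \{v,w\}\in E(\Gamma)\,\rangle$ be its right-angled Artin group. Let $\|g\|$ denote the word length of $g\in A(\Gamma)$ with respect to $V(\Gamma)^{\pm1}$, and let $\|g\|_*$ denote its star length, the least $\ell\ge 0$ such that $g$ is a product of $\ell$ elements each of which lies in the centralizer of some vertex. An element $g\neq 1$ is primitive if it is not of the form $k^n$ with $k\in A(\Gamma)$ and $n\ge 2$. A quasi-root decomposition of $h$ is an expression $h=ag^nb$ with $a,b,g\in A(\Gamma)$, $g\ne1$, $n\ge1$ and $\|h\|=\|a\|+n\|g\|+\|b\|$; if moreover $\|a\|_*\le A$, $\|b\|_*\le B$ and $\|g\|_*\le r$, then $g$ is called an $(A,B,r)^*$-quasi-root of $h$. Let $h\in A(\Gamma)$, and let $A,B\ge 0$ and $r\ge 1$ be real numbers with $$\|h\|_*\ \ge\ 2A+2B+(2V+3)r+2 .$$ Then any two primitive $(A,B,r)^*$-quasi-roots of $h$ are conjugate in $A(\Gamma)$. Moreover, their leftward and rightward extractions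 are unique: if $h=a_1g_1^{n_1}b_1=a_2g_2^{n_2}b_2$ are two quasi-root decompositions of $h$ such that, for $i=1,2$, $g_i$ is primitive, $\|a_i\|_*\le A$, $\|b_i\|_*\le B$ and $\|g_i\|_*\le r$, then $$a_1g_1a_1^{-1}=a_2g_2a_2^{-1}\qquad\text{and}\qquad b_1^{-1}g_1b_1=b_2^{-1}g_2b_2 .$$ -/

import Mathlib

universe u

/-- The right-angled Artin group of `Γ`: one generator for each vertex, and adjacent
vertices commute. -/
abbrev RAAG {V : Type u} (Γ : SimpleGraph V) : Type u :=
  PresentedGroup {x : FreeGroup V | ∃ v w : V, Γ.Adj v w ∧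
    x = FreeGroup.of v * FreeGroup.of w * (FreeGroup.of v)⁻¹ * (FreeGroup.of w)⁻¹}

namespace RAAG

variable {V : Type u} {Γ : SimpleGraph V}

/-- The generator of the right-angled Artin group that belongs to the vertex `v`. -/
def gen (Γ : SimpleGraph V) (v : V) : RAAG Γ := PresentedGroup.of v

/-- A letter is a vertex or the formal inverse of a vertex; `(v, true)` stands for `v` and
`(v, false)` for its inverse. -/
def letterVal (Γ : SimpleGraph V) (x : V × Bool) : RAAG Γ :=
  if x.2 then gen Γ x.1 else (gen Γ x.1)⁻¹

/-- The element of the group represented by a word. -/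
def wordVal (Γ : SimpleGraph V) (w : List (V × Bool)) : RAAG Γ :=
  (w.map (letterVal Γ)).prod

/-- The word length: the least length of a word in the vertices and their inverses that
represents `g`. -/
noncomputable def wordLength (g : RAAG Γ) : ℕ :=
  sInf {n : ℕ | ∃ w : List (V × Bool), wordVal Γ w = g ∧ w.length = n}

/-- A star-word is an element of the centralizer of some vertex. -/
def IsStarWord (g : RAAG Γ) : Prop :=
  ∃ v : V, g ∈ Subgroup.centralizer {gen Γ v}

/-- The star length: the least number of star-words whose product is `g`. -/
noncomputable def starLength (g : RAAG Γ) : ℕ :=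
  sInf {n : ℕ | ∃ l : List (RAAG Γ), (∀ s ∈ l, IsStarWord s) ∧ l.prod = g ∧ l.length = n}

/-- A nontrivial element that is not a proper power. -/
def IsPrimitive (g : RAAG Γ) : Prop :=
  g ≠ 1 ∧ ∀ (k : RAAG Γ) (n : ℕ), 2 ≤ n → g ≠ k ^ n

/-- `h = a * g ^ n * b` is a quasi-root decomposition of `h` with quasi-root `g`. -/
structure IsQuasiRootDecomp (h a g b : RAAG Γ) (n : ℕ) : Prop where
  ne_one : g ≠ 1
  one_le : 1 ≤ n
  eq_mul : h = a * g ^ n * b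
  length_eq : wordLength h = wordLength a + wordLength b + n * wordLength g

/-- A quasi-root decomposition whose parts satisfy the star-length bounds `A`, `B`, `r`. -/
structure IsStarQuasiRootDecomp (A B r : ℝ) (h a g b : RAAG Γ) (n : ℕ) : Prop
    extends IsQuasiRootDecomp h a g b n where
  left_le : (starLength a : ℝ) ≤ A
  right_le : (starLength b : ℝ) ≤ B
  root_le : (starLength g : ℝ) ≤ r

/-- `g` is an `(A, B, r)^*`-quasi-root of `h`. -/
def IsStarQuasiRoot (A B r : ℝ) (h g : RAAG Γ) : Prop :=
  ∃ (a b : RAAG Γ) (n : ℕ), IsStarQuasiRootDecomp A B r h a g b n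

/-- Every element is represented by a word, so that the minimum in `wordLength` is attained. -/
theorem exists_wordVal_eq (g : RAAG Γ) : ∃ w : List (V × Bool), wordVal Γ w = g := by
  obtain ⟨x, rfl⟩ := PresentedGroup.mk_surjective _ g
  induction x using FreeGroup.induction_on with
  | C1 => exact ⟨[], by simp [wordVal]⟩
  | of v => exact ⟨[(v, true)], by simp [wordVal, letterVal, gen, PresentedGroup.of]⟩
  | inv_of v _ => exact ⟨[(v, false)], by simp [wordVal, letterVal, gen, PresentedGroup.of]⟩
  | mul x y hx hy =>
    obtain ⟨w, hw⟩ := hx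
    obtain ⟨w', hw'⟩ := hy
    exact ⟨w ++ w', by rw [map_mul, ← hw, ← hw']; simp [wordVal]⟩

/-- Every letter is a star-word, so that the minimum in `starLength` is attained. -/
theorem exists_starWords_prod_eq (g : RAAG Γ) :
    ∃ l : List (RAAG Γ), (∀ s ∈ l, IsStarWord s) ∧ l.prod = g := by
  obtain ⟨w, hw⟩ := exists_wordVal_eq g
  refine ⟨w.map (letterVal Γ), ?_, hw⟩
  intro s hs
  obtain ⟨⟨v, ε⟩, -, rfl⟩ := List.mem_map.1 hs
  refine ⟨v, ?_⟩
  rw [Subgroup.mem_centralizer_singleton_iff]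
  cases ε <;> simp [letterVal]

end RAAG

/-!
A letter of vertex `y` read along a word, after the prefix `U`, crosses a wall, which is recorded by
the conjugate of `y` by `U`; the walls of a reduced word, numbered separately for each vertex `y`,
depend only on the element it represents. In a reduced word `a g ^ n b`, conjugation by `a g a⁻¹`
shifts the walls of `y` along the part `g ^ n` by the number of letters of `y` in `g`.

For two factorizations `h = aᵢ gᵢ ^ nᵢ bᵢ`, Levi's lemma cuts off a prefix and a suffix, covered by
the stars that cover the `aᵢ`, `bᵢ` and one copy of each `gᵢ`, such that both elements
`uᵢ = aᵢ gᵢ aᵢ⁻¹` shift the walls of the remaining middle factor, with room for a shift by the other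
period. By the bound on the star length, the middle factor is not a product of two star-words.

* An element that fixes all walls of the middle factor is trivial, since otherwise the middle factor
  would lie in a star. Hence `u₁` and `u₂` commute.
* By the argument of Fine and Wilf, the ratio of the two periods is the same for any two nonadjacent
  vertices of the middle factor. The vertices with a given ratio are thus adjacent to all others, so
  that two stars would suffice if there were two ratios.
* With a single ratio, Fine–Wilf gives `u₁ ^ m = u₂ ^ n` with `m` and `n` coprime, and the commuting
  elements `u₁` and `u₂` are powers of a common element, which primitivity makes equal to both.
-/

section Periods

variable {α : Type*} {a b : α → α} {T : ℕ → α} {s e p q : ℕ}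

/-- A form of the Fine–Wilf theorem: if neither shift can be carried out inside the window, then a
shift by `q` can be undone, because the window is longer than `p + q`. -/
theorem iterate_eq_iterate_of_periodic (hab : Function.Commute a b)
    (ha : ∀ j, s ≤ j → j + p < e → T (j + p) = a (T j))
    (hb : ∀ j, s ≤ j → j + q < e → T (j + q) = b (T j)) (hse : s + p + q ≤ e) {j k m n : ℕ}
    (hj : s ≤ j) (hje : j < e) (hk : s ≤ k) (hke : k < e) (h : j + m * p = k + n * q) :
    a^[m] (T j) = b^[n] (T k) := by
  induction hN : m + n generalizing j k m n with
  | zero =>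
    obtain ⟨rfl, rfl⟩ := Nat.add_eq_zero_iff.1 hN
    simp_all
  | succ N ih =>
    rcases m with _ | m
    · obtain ⟨n, rfl⟩ : ∃ n', n = n' + 1 := ⟨N, by omega⟩
      have hkq : k + q < e := by
        rw [Nat.succ_mul] at h
        omega
      rw [Function.iterate_succ_apply, ← hb k hk hkq]
      exact ih hj hje (by omega) hkq (by rw [h]; ring) (by omega)
    · rw [Nat.succ_mul] at h
      by_cases hjp : j + p < e
      · rw [Function.iterate_succ_apply, ← ha j hj hjp]
        refine ih (by omega) hjp hk hke ?_ ?_ <;> omega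
      · rcases n with _ | n
        · omega
        · have hjq : T j = b (T (j - q)) := by
            rw [← hb (j - q) (by omega) (by omega), Nat.sub_add_cancel (by omega)]
          rw [Nat.succ_mul] at h
          rw [hjq, (hab.iterate_left (m + 1)).eq, Function.iterate_succ_apply' b]
          refine congrArg b (ih (m := m + 1) (n := n) (by omega) (by omega) hk hke ?_ (by omega))
          rw [Nat.succ_mul]
          omega

end Periods

theorem iterate_conj_apply {G : Type*} [Group G] (u t : G) (m : ℕ) :
    (MulAut.conj u)^[m] t = MulAut.conj (u ^ m) t := by
  induction m with
  | zero => simp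
  | succ m ih =>
    rw [Function.iterate_succ_apply', ih, ← MulAut.mul_apply, ← map_mul, ← pow_succ']

theorem conj_apply_eq_conj_apply_iff {G : Type*} [Group G] {u v t : G} :
    MulAut.conj u t = MulAut.conj v t ↔ Commute (v⁻¹ * u) t := by
  rw [MulAut.conj_apply, MulAut.conj_apply, commute_iff_eq, mul_inv_eq_iff_eq_mul, mul_assoc v⁻¹,
    inv_mul_eq_iff_eq_mul]
  simp only [mul_assoc]

theorem exists_eq_pow_of_commute_of_coprime {G : Type*} [Group G] {u v : G} {m n : ℕ}
    (huv : Commute u v) (hmn : m.Coprime n) (h : u ^ m = v ^ n) : ∃ k, u = k ^ n ∧ v = k ^ m := by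
  have hcomm : Commute (u : WithZero G) v := congrArg _ huv.eq
  obtain ⟨k, hu, hv⟩ := (hcomm.pow_eq_pow_iff_of_coprime hmn).1 (by exact_mod_cast h)
  cases k with
  | zero =>
    have hn : n = 0 := by by_contra hn; simp [zero_pow hn] at hu
    have hm : m = 0 := by by_contra hm; simp [zero_pow hm] at hv
    simp [hm, hn] at hmn
  | coe k => exact ⟨k, by exact_mod_cast hu, by exact_mod_cast hv⟩

namespace RAAG

variable {V : Type u} {Γ : SimpleGraph V}

/-- Words in the vertices and their formal inverses. -/
abbrev Word (V : Type u) : Type u := List (V × Bool)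

/-- The formal inverse of a letter. -/
def invLetter (x : V × Bool) : V × Bool := (x.1, !x.2)

@[simp] theorem invLetter_invLetter (x : V × Bool) : invLetter (invLetter x) = x := by
  simp [invLetter]

@[simp] theorem letterVal_invLetter (x : V × Bool) :
    letterVal Γ (invLetter x) = (letterVal Γ x)⁻¹ := by
  rcases x with ⟨v, _ | _⟩ <;> simp [letterVal, invLetter]

theorem commute_gen_of_adj {v w : V} (h : Γ.Adj v w) : Commute (gen Γ v) (gen Γ w) := by
  have hrel : PresentedGroup.mk {x : FreeGroup V | ∃ v w : V, Γ.Adj v w ∧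
      x = FreeGroup.of v * FreeGroup.of w * (FreeGroup.of v)⁻¹ * (FreeGroup.of w)⁻¹}
      (FreeGroup.of v * FreeGroup.of w * (FreeGroup.of v)⁻¹ * (FreeGroup.of w)⁻¹) = 1 :=
    PresentedGroup.one_of_mem ⟨v, w, h, rfl⟩
  simp only [map_mul, map_inv] at hrel
  rwa [mul_inv_eq_one, mul_inv_eq_iff_eq_mul] at hrel

theorem commute_letterVal_iff {x : V × Bool} {z : RAAG Γ} :
    Commute z (letterVal Γ x) ↔ Commute z (gen Γ x.1) := by
  unfold letterVal
  split_ifs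
  · rfl
  · exact Commute.inv_right_iff

theorem commute_letterVal_of_adj {x y : V × Bool} (h : Γ.Adj x.1 y.1) :
    Commute (letterVal Γ x) (letterVal Γ y) :=
  commute_letterVal_iff.2 (commute_letterVal_iff.2 (commute_gen_of_adj h).symm).symm

@[simp] theorem wordVal_nil : wordVal Γ [] = 1 := rfl

@[simp] theorem wordVal_cons (x : V × Bool) (W : Word V) :
    wordVal Γ (x :: W) = letterVal Γ x * wordVal Γ W := by simp [wordVal]

@[simp] theorem wordVal_append (U W : Word V) :
    wordVal Γ (U ++ W) = wordVal Γ U * wordVal Γ W := by simp [wordVal]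

/-! ### Words up to commutation -/

/-- Trace equivalence: two words differ by exchanges of neighbouring letters whose vertices are
adjacent. -/
inductive TraceEquiv (Γ : SimpleGraph V) : Word V → Word V → Prop
  | nil : TraceEquiv Γ [] []
  | cons (x : V × Bool) {W W' : Word V} : TraceEquiv Γ W W' → TraceEquiv Γ (x :: W) (x :: W')
  | swap (x y : V × Bool) (W : Word V) :
      Γ.Adj x.1 y.1 → TraceEquiv Γ (x :: y :: W) (y :: x :: W)
  | trans {U W W' : Word V} : TraceEquiv Γ U W → TraceEquiv Γ W W' → TraceEquiv Γ U W'

namespace TraceEquiv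

variable {U U' W W' : Word V}

@[refl] theorem refl : ∀ W : Word V, TraceEquiv Γ W W
  | [] => nil
  | x :: W => cons x (refl W)

@[symm] theorem symm (h : TraceEquiv Γ W W') : TraceEquiv Γ W' W := by
  induction h with
  | nil => exact nil
  | cons x _ ih => exact cons x ih
  | swap x y W h => exact swap y x W h.symm
  | trans _ _ ih ih' => exact ih'.trans ih

theorem perm (h : TraceEquiv Γ W W') : W.Perm W' := by
  induction h with
  | nil => exact List.Perm.nil
  | cons x _ ih => exact ih.cons x
  | swap x y W _ => exact List.Perm.swap y x W
  | trans _ _ ih ih' => exact ih.trans ih'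

theorem wordVal_eq (h : TraceEquiv Γ W W') : wordVal Γ W = wordVal Γ W' := by
  induction h with
  | nil => rfl
  | cons x _ ih => simp [ih]
  | swap x y W h => simp [← mul_assoc, (commute_letterVal_of_adj h).eq]
  | trans _ _ ih ih' => exact ih.trans ih'

theorem append_left (U : Word V) (h : TraceEquiv Γ W W') : TraceEquiv Γ (U ++ W) (U ++ W') := by
  induction U with
  | nil => exact h
  | cons x U ih => exact cons x ih

theorem append_right (U : Word V) (h : TraceEquiv Γ W W') : TraceEquiv Γ (W ++ U) (W' ++ U) := by
  induction h with
  | nil => exact refl U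
  | cons x _ ih => exact cons x ih
  | swap x y W h => exact swap x y _ h
  | trans _ _ ih ih' => exact ih.trans ih'

theorem cons_append_of_adj (x : V × Bool) (W : Word V) {U : Word V}
    (h : ∀ b ∈ U, Γ.Adj x.1 b.1) : TraceEquiv Γ (x :: (U ++ W)) (U ++ x :: W) := by
  induction U with
  | nil => exact refl _
  | cons y U ih =>
    rw [List.forall_mem_cons] at h
    exact (swap x y _ h.1).trans (cons y (ih h.2))

theorem append_comm_of_adj (h : ∀ a ∈ U, ∀ b ∈ W, Γ.Adj a.1 b.1) :
    TraceEquiv Γ (U ++ W) (W ++ U) := by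
  induction U with
  | nil => simpa using refl W
  | cons x U ih =>
    rw [List.forall_mem_cons] at h
    exact (cons x (ih h.2)).trans (cons_append_of_adj x U h.1)

theorem reverse (h : TraceEquiv Γ W W') : TraceEquiv Γ W.reverse W'.reverse := by
  induction h with
  | nil => exact nil
  | cons x _ ih => simpa using ih.append_right [x]
  | swap x y W h => simpa using (swap y x [] h.symm).append_left W.reverse
  | trans _ _ ih ih' => exact ih.trans ih'

theorem exists_sublist (h : TraceEquiv Γ W W') (hU : U.Sublist W) :
    ∃ U', U'.Sublist W' ∧ TraceEquiv Γ U U' := by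
  induction h generalizing U with
  | nil => exact ⟨U, hU, refl U⟩
  | cons x _ ih =>
    cases hU with
    | cons _ h =>
      obtain ⟨U', hsub, hequiv⟩ := ih h
      exact ⟨U', hsub.cons x, hequiv⟩
    | cons_cons _ h =>
      obtain ⟨U', hsub, hequiv⟩ := ih h
      exact ⟨x :: U', hsub.cons_cons x, hequiv.cons x⟩
  | swap x y W hxy =>
    cases hU with
    | cons _ h =>
      cases h with
      | cons _ h => exact ⟨_, (h.cons x).cons y, refl _⟩
      | cons_cons _ h => exact ⟨_, (h.cons x).cons_cons y, refl _⟩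
    | cons_cons _ h =>
      cases h with
      | cons _ h => exact ⟨_, (h.cons_cons x).cons y, refl _⟩
      | cons_cons _ h => exact ⟨_, (h.cons_cons x).cons_cons y, swap _ _ _ hxy⟩
  | trans _ _ ih ih' =>
    obtain ⟨U₁, hsub₁, hequiv₁⟩ := ih hU
    obtain ⟨U₂, hsub₂, hequiv₂⟩ := ih' hsub₁
    exact ⟨U₂, hsub₂, hequiv₁.trans hequiv₂⟩

end TraceEquiv

theorem traceEquiv_filter_append_filter_not {p : V × Bool → Bool} {W : Word V}
    (h : ∀ a ∈ W, ∀ b ∈ W, p a → ¬ p b → Γ.Adj a.1 b.1) :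
    TraceEquiv Γ W (W.filter p ++ W.filter fun b => !p b) := by
  induction W with
  | nil => exact TraceEquiv.nil
  | cons a W ih =>
    have ih := ih fun b hb c hc => h b (List.mem_cons_of_mem _ hb) c (List.mem_cons_of_mem _ hc)
    by_cases ha : p a
    · simpa [ha] using ih.cons a
    · rw [List.filter_cons_of_neg ha, List.filter_cons_of_pos (by simpa using ha)]
      refine (ih.cons a).trans (TraceEquiv.cons_append_of_adj a _ fun b hb => ?_)
      obtain ⟨hbW, hb⟩ := List.mem_filter.1 hb
      exact (h b (List.mem_cons_of_mem _ hbW) a List.mem_cons_self hb ha).symm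

open scoped Classical in
/-- Removes a letter `x` that can be exchanged to the front of a word; the value is `none` if there
is no such letter. -/
noncomputable def stripFront (Γ : SimpleGraph V) (x : V × Bool) : Word V → Option (Word V)
  | [] => none
  | y :: W => if y = x then some W else
      if Γ.Adj x.1 y.1 then (stripFront Γ x W).map (y :: ·) else none

section stripFront

variable {U W W' : Word V} {x y : V × Bool}

@[simp] theorem stripFront_nil : stripFront Γ x [] = none := rfl

@[simp] theorem stripFront_cons_self : stripFront Γ x (x :: W) = some W := by simp [stripFront]

theorem stripFront_cons_of_adj (h : Γ.Adj x.1 y.1) :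
    stripFront Γ x (y :: W) = (stripFront Γ x W).map (y :: ·) := by
  have : y ≠ x := by rintro rfl; exact Γ.irrefl h
  simp [stripFront, h, this]

theorem stripFront_cons_of_not_adj (h : ¬ Γ.Adj x.1 y.1) (h' : y ≠ x) :
    stripFront Γ x (y :: W) = none := by
  simp [stripFront, h, h']

theorem stripFront_cons_eq_some_iff :
    stripFront Γ x (y :: W) = some U ↔
      y = x ∧ U = W ∨ Γ.Adj x.1 y.1 ∧ ∃ U', stripFront Γ x W = some U' ∧ U = y :: U' := by
  by_cases hadj : Γ.Adj x.1 y.1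
  · have : y ≠ x := by rintro rfl; exact Γ.irrefl hadj
    simp [stripFront_cons_of_adj hadj, hadj, this, eq_comm]
  · by_cases hyx : y = x
    · subst hyx
      simp [eq_comm]
    · simp [stripFront_cons_of_not_adj hadj hyx, hadj, hyx]

theorem traceEquiv_of_stripFront (h : stripFront Γ x W = some U) : TraceEquiv Γ W (x :: U) := by
  induction W generalizing U with
  | nil => simp at h
  | cons y W ih =>
    rcases stripFront_cons_eq_some_iff.1 h with ⟨rfl, rfl⟩ | ⟨hadj, U', hU', rfl⟩
    · rfl
    · exact ((ih hU').cons y).trans (TraceEquiv.swap y x U' hadj.symm)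

namespace TraceEquiv

theorem exists_stripFront (h : TraceEquiv Γ W W') (hU : stripFront Γ x W = some U) :
    ∃ U', stripFront Γ x W' = some U' ∧ TraceEquiv Γ U U' := by
  induction h generalizing U with
  | nil => simp at hU
  | cons y hW ih =>
    rcases stripFront_cons_eq_some_iff.1 hU with ⟨rfl, rfl⟩ | ⟨hadj, U₁, hU₁, rfl⟩
    · exact ⟨_, stripFront_cons_self, hW⟩
    · obtain ⟨U₂, hU₂, hequiv⟩ := ih hU₁
      exact ⟨y :: U₂, by simp [stripFront_cons_of_adj hadj, hU₂], hequiv.cons y⟩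
  | swap a b W hab =>
    rcases stripFront_cons_eq_some_iff.1 hU with ⟨rfl, rfl⟩ | ⟨hxa, U₁, hU₁, rfl⟩
    · exact ⟨b :: W, by simp [stripFront_cons_of_adj hab], refl _⟩
    · rcases stripFront_cons_eq_some_iff.1 hU₁ with ⟨rfl, rfl⟩ | ⟨hxb, U₂, hU₂, rfl⟩
      · exact ⟨_, stripFront_cons_self, refl _⟩
      · refine ⟨b :: a :: U₂, ?_, swap a b U₂ hab⟩
        simp [stripFront_cons_of_adj hxa, stripFront_cons_of_adj hxb, hU₂]
  | trans _ _ ih ih' =>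
    obtain ⟨U₁, hU₁, hequiv₁⟩ := ih hU
    obtain ⟨U₂, hU₂, hequiv₂⟩ := ih' hU₁
    exact ⟨U₂, hU₂, hequiv₁.trans hequiv₂⟩

theorem stripFront_eq_none (h : TraceEquiv Γ W W') (hx : stripFront Γ x W = none) :
    stripFront Γ x W' = none := by
  rw [Option.eq_none_iff_forall_ne_some]
  intro U hU
  obtain ⟨U', hU', -⟩ := h.symm.exists_stripFront hU
  simp [hx] at hU'

end TraceEquiv

theorem stripFront_append_eq_some (h : stripFront Γ x (W ++ W') = some U) :
    (∃ U', stripFront Γ x W = some U' ∧ U = U' ++ W') ∨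
      (∀ b ∈ W, Γ.Adj x.1 b.1) ∧ ∃ U', stripFront Γ x W' = some U' ∧ U = W ++ U' := by
  induction W generalizing U with
  | nil => exact Or.inr ⟨by simp, U, h, rfl⟩
  | cons y W ih =>
    rcases stripFront_cons_eq_some_iff.1 h with ⟨rfl, rfl⟩ | ⟨hadj, U₁, hU₁, rfl⟩
    · exact Or.inl ⟨W, stripFront_cons_self, rfl⟩
    · rcases ih hU₁ with ⟨U', hU', rfl⟩ | ⟨hW, U', hU', rfl⟩
      · exact Or.inl ⟨y :: U', by simp [stripFront_cons_of_adj hadj, hU'], rfl⟩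
      · exact Or.inr ⟨List.forall_mem_cons.2 ⟨hadj, hW⟩, U', hU', rfl⟩

theorem TraceEquiv.exists_levi {X Y Z E : Word V} (h : TraceEquiv Γ (X ++ Y) (Z ++ E)) :
    ∃ P Q R S, TraceEquiv Γ X (P ++ Q) ∧ TraceEquiv Γ Y (R ++ S) ∧ TraceEquiv Γ Z (P ++ R) ∧
      TraceEquiv Γ E (Q ++ S) ∧ ∀ a ∈ Q, ∀ b ∈ R, Γ.Adj a.1 b.1 := by
  induction X generalizing Z E with
  | nil => exact ⟨[], [], Z, E, refl _, h, refl _, refl _, by simp⟩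
  | cons a X ih =>
    obtain ⟨U, hU, hequiv⟩ := h.exists_stripFront stripFront_cons_self
    rcases stripFront_append_eq_some hU with ⟨Z', hZ', rfl⟩ | ⟨hZ, E', hE', rfl⟩
    · obtain ⟨P, Q, R, S, hX, hY, hZ, hE, hadj⟩ := ih hequiv
      exact ⟨a :: P, Q, R, S, hX.cons a, hY, (traceEquiv_of_stripFront hZ').trans (hZ.cons a), hE,
        hadj⟩
    · obtain ⟨P, Q, R, S, hX, hY, hZ', hE, hadj⟩ := ih hequiv
      have hPR : ∀ b ∈ P ++ R, Γ.Adj a.1 b.1 := fun b hb => hZ b (hZ'.perm.mem_iff.2 hb)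
      rw [List.forall_mem_append] at hPR
      exact ⟨P, a :: Q, R, S, (hX.cons a).trans (cons_append_of_adj a Q hPR.1), hY, hZ',
        (traceEquiv_of_stripFront hE').trans (hE.cons a), List.forall_mem_cons.2 ⟨hPR.2, hadj⟩⟩

end stripFront

/-! ### Reduced words -/

/-- A word in which no letter can be exchanged next to its inverse. -/
def IsReduced (Γ : SimpleGraph V) : Word V → Prop
  | [] => True
  | x :: W => IsReduced Γ W ∧ stripFront Γ (invLetter x) W = none

/-- Left multiplication by a letter, which cancels against its inverse if possible. -/
noncomputable def mulLetter (Γ : SimpleGraph V) (x : V × Bool) (W : Word V) : Word V :=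
  (stripFront Γ (invLetter x) W).getD (x :: W)

section mulLetter

variable {U W W' : Word V} {x y : V × Bool}

theorem IsReduced.of_traceEquiv (hW : IsReduced Γ W) (h : TraceEquiv Γ W W') :
    IsReduced Γ W' := by
  induction h with
  | nil => trivial
  | cons x h ih => exact ⟨ih hW.1, h.stripFront_eq_none hW.2⟩
  | swap x y W h =>
    obtain ⟨⟨hW, hy⟩, hx⟩ := hW
    rw [stripFront_cons_of_adj (x := invLetter x) h, Option.map_eq_none_iff] at hx
    refine ⟨⟨hW, hx⟩, ?_⟩
    rw [stripFront_cons_of_adj (x := invLetter y) h.symm, hy]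
    rfl
  | trans _ _ ih ih' => exact ih' (ih hW)

theorem mulLetter_of_eq_none (h : stripFront Γ (invLetter x) W = none) :
    mulLetter Γ x W = x :: W := by
  simp [mulLetter, h]

theorem mulLetter_of_eq_some (h : stripFront Γ (invLetter x) W = some U) :
    mulLetter Γ x W = U := by
  simp [mulLetter, h]

theorem IsReduced.mulLetter (hW : IsReduced Γ W) (x : V × Bool) :
    IsReduced Γ (mulLetter Γ x W) := by
  cases h : stripFront Γ (invLetter x) W with
  | none => exact mulLetter_of_eq_none h ▸ ⟨hW, h⟩
  | some U => exact mulLetter_of_eq_some h ▸ (hW.of_traceEquiv (traceEquiv_of_stripFront h)).1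

theorem TraceEquiv.mulLetter (h : TraceEquiv Γ W W') (x : V × Bool) :
    TraceEquiv Γ (mulLetter Γ x W) (mulLetter Γ x W') := by
  cases hs : stripFront Γ (invLetter x) W with
  | none =>
    rw [mulLetter_of_eq_none hs, mulLetter_of_eq_none (h.stripFront_eq_none hs)]
    exact h.cons x
  | some U =>
    obtain ⟨U', hU', hequiv⟩ := h.exists_stripFront hs
    rwa [mulLetter_of_eq_some hs, mulLetter_of_eq_some hU']

theorem mulLetter_traceEquiv_of_cons (h : TraceEquiv Γ W (invLetter x :: U)) :
    TraceEquiv Γ (mulLetter Γ x W) U := by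
  simpa only [mulLetter_of_eq_some stripFront_cons_self] using h.mulLetter x

theorem mulLetter_mulLetter_invLetter (hW : IsReduced Γ W) (x : V × Bool) :
    TraceEquiv Γ (mulLetter Γ x (mulLetter Γ (invLetter x) W)) W := by
  cases h : stripFront Γ x W with
  | none =>
    rw [mulLetter_of_eq_none (x := invLetter x) (by simpa using h)]
    exact mulLetter_traceEquiv_of_cons (TraceEquiv.refl _)
  | some U =>
    have hequiv := traceEquiv_of_stripFront h
    rw [mulLetter_of_eq_some (x := invLetter x) (by simpa using h),
      mulLetter_of_eq_none (hW.of_traceEquiv hequiv).2]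
    exact hequiv.symm

theorem mulLetter_cons_of_adj (h : Γ.Adj x.1 y.1) :
    TraceEquiv Γ (mulLetter Γ x (y :: W)) (y :: mulLetter Γ x W) := by
  have hcons := stripFront_cons_of_adj (x := invLetter x) (W := W) h
  cases hs : stripFront Γ (invLetter x) W with
  | none =>
    rw [mulLetter_of_eq_none hs, mulLetter_of_eq_none (by rw [hcons, hs]; rfl)]
    exact TraceEquiv.swap _ _ _ h
  | some U =>
    rw [mulLetter_of_eq_some hs, mulLetter_of_eq_some (by rw [hcons, hs]; rfl)]

theorem mulLetter_comm_of_traceEquiv_cons (hxy : Γ.Adj x.1 y.1)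
    (h : TraceEquiv Γ W (invLetter x :: U)) :
    TraceEquiv Γ (mulLetter Γ x (mulLetter Γ y W)) (mulLetter Γ y (mulLetter Γ x W)) :=
  (mulLetter_traceEquiv_of_cons
    ((h.mulLetter y).trans (mulLetter_cons_of_adj (y := invLetter x) hxy.symm))).trans
    ((mulLetter_traceEquiv_of_cons h).mulLetter y).symm

theorem mulLetter_comm (hxy : Γ.Adj x.1 y.1) (W : Word V) :
    TraceEquiv Γ (mulLetter Γ x (mulLetter Γ y W)) (mulLetter Γ y (mulLetter Γ x W)) := by
  cases hx : stripFront Γ (invLetter x) W with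
  | some U => exact mulLetter_comm_of_traceEquiv_cons hxy (traceEquiv_of_stripFront hx)
  | none =>
    cases hy : stripFront Γ (invLetter y) W with
    | some U =>
      exact (mulLetter_comm_of_traceEquiv_cons hxy.symm (traceEquiv_of_stripFront hy)).symm
    | none =>
      rw [mulLetter_of_eq_none hx, mulLetter_of_eq_none hy]
      refine (mulLetter_cons_of_adj hxy).trans
        (TraceEquiv.trans ?_ (mulLetter_cons_of_adj hxy.symm).symm)
      rw [mulLetter_of_eq_none hx, mulLetter_of_eq_none hy]
      exact TraceEquiv.swap _ _ _ hxy.symm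

theorem wordVal_mulLetter (x : V × Bool) (W : Word V) :
    wordVal Γ (mulLetter Γ x W) = letterVal Γ x * wordVal Γ W := by
  cases h : stripFront Γ (invLetter x) W with
  | none => simp [mulLetter_of_eq_none h]
  | some U => simp [mulLetter_of_eq_some h, (traceEquiv_of_stripFront h).wordVal_eq]

end mulLetter

/-- A reduced word representing the same element, computed from the right. -/
noncomputable def reduce (Γ : SimpleGraph V) (W : Word V) : Word V :=
  W.foldr (mulLetter Γ) []

theorem reduce_cons (x : V × Bool) (W : Word V) :
    reduce Γ (x :: W) = mulLetter Γ x (reduce Γ W) := rfl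

theorem isReduced_reduce (W : Word V) : IsReduced Γ (reduce Γ W) := by
  induction W with
  | nil => trivial
  | cons x W ih => exact ih.mulLetter x

theorem wordVal_reduce (W : Word V) : wordVal Γ (reduce Γ W) = wordVal Γ W := by
  induction W with
  | nil => rfl
  | cons x W ih => rw [reduce_cons, wordVal_mulLetter, ih, wordVal_cons]

theorem IsReduced.reduce_eq {W : Word V} (h : IsReduced Γ W) : reduce Γ W = W := by
  induction W with
  | nil => rfl
  | cons x W ih => rw [reduce_cons, ih h.1, mulLetter_of_eq_none h.2]

theorem exists_sublist_traceEquiv_reduce (Γ : SimpleGraph V) (W : Word V) :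
    ∃ U, U.Sublist W ∧ TraceEquiv Γ U (reduce Γ W) := by
  induction W with
  | nil => exact ⟨[], List.Sublist.refl _, TraceEquiv.nil⟩
  | cons x W ih =>
    obtain ⟨U, hsub, hequiv⟩ := ih
    rw [reduce_cons]
    cases h : stripFront Γ (invLetter x) (reduce Γ W) with
    | none =>
      rw [mulLetter_of_eq_none h]
      exact ⟨x :: U, hsub.cons_cons x, hequiv.cons x⟩
    | some W' =>
      rw [mulLetter_of_eq_some h]
      obtain ⟨U', hsub', hequiv'⟩ := (hequiv.trans (traceEquiv_of_stripFront h)).symm.exists_sublist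
        (List.sublist_cons_self (invLetter x) W')
      exact ⟨U', (hsub'.trans hsub).cons x, hequiv'.symm⟩

/-- Trace equivalence of reduced words. -/
def reducedSetoid (Γ : SimpleGraph V) : Setoid {W : Word V // IsReduced Γ W} where
  r W W' := TraceEquiv Γ W.1 W'.1
  iseqv := ⟨fun W => TraceEquiv.refl W.1, TraceEquiv.symm, TraceEquiv.trans⟩

/-- Reduced words up to trace equivalence. The group acts on this set, and applying an element to
the class of the empty word recovers its reduced word; this makes reduced words unique. -/
abbrev ReducedClass (Γ : SimpleGraph V) : Type u := Quotient (reducedSetoid Γ)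

/-- The class of the reduced form of a word. -/
noncomputable def reducedClass (Γ : SimpleGraph V) (W : Word V) : ReducedClass Γ :=
  Quotient.mk (reducedSetoid Γ) ⟨reduce Γ W, isReduced_reduce W⟩

/-- The action of a letter on classes of reduced words. -/
noncomputable def letterAct (Γ : SimpleGraph V) (x : V × Bool) :
    ReducedClass Γ → ReducedClass Γ :=
  Quotient.map' (s₁ := reducedSetoid Γ) (s₂ := reducedSetoid Γ)
    (fun W => ⟨mulLetter Γ x W.1, W.2.mulLetter x⟩) fun _ _ h => TraceEquiv.mulLetter h x

theorem letterAct_letterAct_invLetter (x : V × Bool) (c : ReducedClass Γ) :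
    letterAct Γ x (letterAct Γ (invLetter x) c) = c := by
  induction c using Quotient.inductionOn with
  | h W => exact Quotient.sound (mulLetter_mulLetter_invLetter W.2 x)

theorem letterAct_comm {x y : V × Bool} (h : Γ.Adj x.1 y.1) (c : ReducedClass Γ) :
    letterAct Γ x (letterAct Γ y c) = letterAct Γ y (letterAct Γ x c) := by
  induction c using Quotient.inductionOn with
  | h W => exact Quotient.sound (mulLetter_comm h W.1)

/-- The permutation of the classes of reduced words given by a vertex. -/
noncomputable def vertexPerm (Γ : SimpleGraph V) (v : V) : Equiv.Perm (ReducedClass Γ) where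
  toFun := letterAct Γ (v, true)
  invFun := letterAct Γ (v, false)
  left_inv := letterAct_letterAct_invLetter (v, false)
  right_inv := letterAct_letterAct_invLetter (v, true)

/-- The action of the group on classes of reduced words by left multiplication. -/
noncomputable def reducedAction (Γ : SimpleGraph V) : RAAG Γ →* Equiv.Perm (ReducedClass Γ) :=
  PresentedGroup.toGroup (f := vertexPerm Γ) <| by
    rintro _ ⟨v, w, h, rfl⟩
    simp only [map_mul, map_inv, FreeGroup.lift_apply_of]
    rw [mul_inv_eq_one, mul_inv_eq_iff_eq_mul]
    ext c
    exact letterAct_comm (x := (v, true)) (y := (w, true)) h c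

theorem reducedAction_gen (v : V) : reducedAction Γ (gen Γ v) = vertexPerm Γ v :=
  PresentedGroup.toGroup.of _

theorem reducedAction_letterVal (x : V × Bool) (c : ReducedClass Γ) :
    reducedAction Γ (letterVal Γ x) c = letterAct Γ x c := by
  rcases x with ⟨v, _ | _⟩
  · simp only [letterVal, Bool.false_eq_true, if_false, map_inv, reducedAction_gen]
    rfl
  · simp only [letterVal, if_true, reducedAction_gen]
    rfl

theorem reducedAction_wordVal (W : Word V) :
    reducedAction Γ (wordVal Γ W) (reducedClass Γ []) = reducedClass Γ W := by
  induction W with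
  | nil => simp
  | cons x W ih =>
    rw [wordVal_cons, map_mul, Equiv.Perm.mul_apply, ih, reducedAction_letterVal]
    rfl

theorem traceEquiv_reduce_of_wordVal_eq {W W' : Word V} (h : wordVal Γ W = wordVal Γ W') :
    TraceEquiv Γ (reduce Γ W) (reduce Γ W') := by
  have hclass : reducedClass Γ W = reducedClass Γ W' := by
    rw [← reducedAction_wordVal, h, reducedAction_wordVal]
  exact Quotient.exact hclass

namespace IsReduced

variable {U W W' : Word V}

theorem traceEquiv_of_wordVal_eq (hW : IsReduced Γ W) (hW' : IsReduced Γ W')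
    (h : wordVal Γ W = wordVal Γ W') : TraceEquiv Γ W W' := by
  simpa only [hW.reduce_eq, hW'.reduce_eq] using traceEquiv_reduce_of_wordVal_eq h

theorem exists_sublist_traceEquiv (hW : IsReduced Γ W) (h : wordVal Γ U = wordVal Γ W) :
    ∃ U', U'.Sublist U ∧ TraceEquiv Γ U' W := by
  obtain ⟨U', hsub, hequiv⟩ := exists_sublist_traceEquiv_reduce Γ U
  exact ⟨U', hsub, hequiv.trans (hW.reduce_eq ▸ traceEquiv_reduce_of_wordVal_eq h)⟩

theorem traceEquiv_of_length_le (hW : IsReduced Γ W) (h : wordVal Γ U = wordVal Γ W)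
    (hlen : U.length ≤ W.length) : TraceEquiv Γ U W := by
  obtain ⟨U', hsub, hequiv⟩ := hW.exists_sublist_traceEquiv h
  obtain rfl := hsub.eq_of_length_le (hequiv.perm.length_eq ▸ hlen)
  exact hequiv

end IsReduced

theorem wordLength_wordVal_le (W : Word V) : wordLength (wordVal Γ W) ≤ W.length :=
  Nat.sInf_le ⟨W, rfl, rfl⟩

theorem exists_geodesic (g : RAAG Γ) : ∃ W, wordVal Γ W = g ∧ W.length = wordLength g := by
  obtain ⟨W, hW⟩ := exists_wordVal_eq g
  exact Nat.sInf_mem (s := {n : ℕ | ∃ w : List (V × Bool), wordVal Γ w = g ∧ w.length = n})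
    ⟨W.length, W, hW, rfl⟩

theorem isReduced_of_length_eq {W : Word V} (h : W.length = wordLength (wordVal Γ W)) :
    IsReduced Γ W := by
  refine (isReduced_reduce W).of_traceEquiv
    ((isReduced_reduce W).traceEquiv_of_length_le (wordVal_reduce W).symm ?_).symm
  rw [h, ← wordVal_reduce W]
  exact wordLength_wordVal_le _

/-! ### Star length of reduced words -/

/-- All letters of the word lie in the closed star of one vertex. -/
def InStar (Γ : SimpleGraph V) (W : Word V) : Prop :=
  ∃ v, ∀ b ∈ W, b.1 = v ∨ Γ.Adj v b.1

theorem InStar.isStarWord {W : Word V} (h : InStar Γ W) : IsStarWord (wordVal Γ W) := by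
  obtain ⟨v, hv⟩ := h
  refine ⟨v, Subgroup.mem_centralizer_singleton_iff.2 ?_⟩
  suffices Commute (gen Γ v) (wordVal Γ W) from this.eq.symm
  refine Commute.list_prod_right _ _ fun s hs => ?_
  obtain ⟨b, hb, rfl⟩ := List.mem_map.1 hs
  rw [commute_letterVal_iff]
  rcases hv b hb with h | h
  · rw [h]
  · exact commute_gen_of_adj h

namespace IsReduced

variable {v : V} {W : Word V}

theorem adj_of_commute (hW : IsReduced Γ W) (h : Commute (gen Γ v) (wordVal Γ W))
    (hpos : stripFront Γ (v, true) W = none) (hneg : stripFront Γ (v, false) W = none) :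
    ∀ b ∈ W, Γ.Adj v b.1 := by
  have hred : IsReduced Γ ((v, true) :: W) := ⟨hW, hneg⟩
  have hval : wordVal Γ (W ++ [(v, true)]) = wordVal Γ ((v, true) :: W) := by
    simpa [letterVal] using h.eq.symm
  obtain ⟨U, hU, -⟩ := (hred.traceEquiv_of_length_le hval (by simp)).symm.exists_stripFront
    stripFront_cons_self
  rcases stripFront_append_eq_some hU with ⟨U', hU', -⟩ | ⟨hadj, -⟩
  · simp [hpos] at hU'
  · exact hadj

theorem mem_star_of_commute (hW : IsReduced Γ W) (h : Commute (gen Γ v) (wordVal Γ W)) :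
    ∀ b ∈ W, b.1 = v ∨ Γ.Adj v b.1 := by
  induction hn : W.length using Nat.strong_induction_on generalizing W with
  | _ n ih =>
  have mem_star_of_stripFront : ∀ ε U, stripFront Γ (v, ε) W = some U →
      ∀ b ∈ W, b.1 = v ∨ Γ.Adj v b.1 := by
    intro ε U hU b hb
    have hequiv := traceEquiv_of_stripFront hU
    have hlen : W.length = U.length + 1 := hequiv.perm.length_eq
    have hval : wordVal Γ U = (letterVal Γ (v, ε))⁻¹ * wordVal Γ W := by simp [hequiv.wordVal_eq]
    have hcomm : Commute (gen Γ v) (wordVal Γ U) :=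
      hval ▸ Commute.mul_right (Commute.inv_right (commute_letterVal_iff.2 rfl)) h
    rcases List.mem_cons.1 (hequiv.perm.mem_iff.1 hb) with rfl | hb
    · exact Or.inl rfl
    · exact ih U.length (by omega) (hW.of_traceEquiv hequiv).1 hcomm rfl b hb
  cases hpos : stripFront Γ (v, true) W with
  | some U => exact mem_star_of_stripFront _ U hpos
  | none =>
    cases hneg : stripFront Γ (v, false) W with
    | some U => exact mem_star_of_stripFront _ U hneg
    | none => exact fun b hb => Or.inr (hW.adj_of_commute h hpos hneg b hb)

end IsReduced

theorem IsStarWord.exists_inStar {g : RAAG Γ} (h : IsStarWord g) :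
    ∃ W, wordVal Γ W = g ∧ InStar Γ W := by
  obtain ⟨v, hv⟩ := h
  obtain ⟨W, rfl, hW⟩ := exists_geodesic g
  exact ⟨W, rfl, v, (isReduced_of_length_eq hW).mem_star_of_commute
    (Subgroup.mem_centralizer_singleton_iff.1 hv).symm⟩

/-- `HasStarCover Γ k W`: up to trace equivalence, `W` is a concatenation of `k` words each of which
lies in a star. For reduced words the least such `k` is the star length. -/
inductive HasStarCover (Γ : SimpleGraph V) : ℕ → Word V → Prop
  | nil : HasStarCover Γ 0 []
  | cons {k : ℕ} {U W W' : Word V} : InStar Γ U → HasStarCover Γ k W' →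
      TraceEquiv Γ W (U ++ W') → HasStarCover Γ (k + 1) W

namespace HasStarCover

variable {k l : ℕ} {U W W' : Word V}

theorem of_traceEquiv (h : HasStarCover Γ k W) (hequiv : TraceEquiv Γ W W') :
    HasStarCover Γ k W' := by
  cases h with
  | nil => exact hequiv.perm.nil_eq ▸ nil
  | cons hU hW h => exact cons hU hW (hequiv.symm.trans h)

theorem of_inStar (h : InStar Γ W) : HasStarCover Γ 1 W :=
  cons h nil (by simpa using TraceEquiv.refl W)

theorem sublist (h : HasStarCover Γ k W) (hU : U.Sublist W) : HasStarCover Γ k U := by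
  induction h generalizing U with
  | nil => exact List.sublist_nil.1 hU ▸ nil
  | cons hstar _ hequiv ih =>
    obtain ⟨U', hU', hequiv'⟩ := hequiv.exists_sublist hU
    obtain ⟨v, hv⟩ := hstar
    obtain ⟨U₁, U₂, rfl, hU₁, hU₂⟩ := List.sublist_append_iff.1 hU'
    exact cons ⟨v, fun b hb => hv b (hU₁.subset hb)⟩ (ih hU₂) hequiv'

theorem append (h : HasStarCover Γ k W) (h' : HasStarCover Γ l W') :
    HasStarCover Γ (k + l) (W ++ W') := by
  induction h with
  | nil => simpa using h'
  | cons hstar _ hequiv ih =>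
    rw [Nat.add_right_comm]
    refine cons hstar ih ?_
    simpa only [List.append_assoc] using hequiv.append_right W'

theorem reverse (h : HasStarCover Γ k W) : HasStarCover Γ k W.reverse := by
  induction h with
  | nil => exact nil
  | @cons k U W W' hstar _ hequiv ih =>
    have hU : InStar Γ U.reverse := by simpa only [InStar, List.mem_reverse] using hstar
    refine (ih.append (of_inStar hU)).of_traceEquiv ?_
    simpa only [List.reverse_append] using hequiv.symm.reverse

theorem starLength_le (h : HasStarCover Γ k W) : starLength (wordVal Γ W) ≤ k := by
  suffices ∃ l : List (RAAG Γ), (∀ s ∈ l, IsStarWord s) ∧ l.prod = wordVal Γ W ∧ l.length = k from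
    Nat.sInf_le this
  induction h with
  | nil => exact ⟨[], by simp⟩
  | @cons k U W W' hstar _ hequiv ih =>
    obtain ⟨l, hl, hprod, hlen⟩ := ih
    exact ⟨wordVal Γ U :: l, List.forall_mem_cons.2 ⟨hstar.isStarWord, hl⟩,
      by simp [hprod, hequiv.wordVal_eq], by simp [hlen]⟩

end HasStarCover

theorem exists_hasStarCover_of_isStarWord {l : List (RAAG Γ)} (h : ∀ s ∈ l, IsStarWord s) :
    ∃ U, wordVal Γ U = l.prod ∧ HasStarCover Γ l.length U := by
  induction l with
  | nil => exact ⟨[], by simp, HasStarCover.nil⟩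
  | cons s l ih =>
    rw [List.forall_mem_cons] at h
    obtain ⟨U, hU, hcover⟩ := ih h.2
    obtain ⟨U', hU', hstar⟩ := h.1.exists_inStar
    exact ⟨U' ++ U, by simp [hU, hU'], hcover.cons hstar (TraceEquiv.refl _)⟩

theorem IsReduced.hasStarCover {W : Word V} (hW : IsReduced Γ W) :
    HasStarCover Γ (starLength (wordVal Γ W)) W := by
  obtain ⟨l, hl, hprod, hlen⟩ : ∃ l : List (RAAG Γ), (∀ s ∈ l, IsStarWord s) ∧
      l.prod = wordVal Γ W ∧ l.length = starLength (wordVal Γ W) := by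
    obtain ⟨l, hl, hprod⟩ := exists_starWords_prod_eq (wordVal Γ W)
    exact Nat.sInf_mem (s := {n : ℕ | ∃ l : List (RAAG Γ), (∀ s ∈ l, IsStarWord s) ∧
      l.prod = wordVal Γ W ∧ l.length = n}) ⟨l.length, l, hl, hprod, rfl⟩
  obtain ⟨U, hU, hcover⟩ := exists_hasStarCover_of_isStarWord hl
  obtain ⟨U', hsub, hequiv⟩ := hW.exists_sublist_traceEquiv (hU.trans hprod)
  exact hlen ▸ (hcover.sublist hsub).of_traceEquiv hequiv

theorem hasStarCover_two_of_adj {p : V × Bool → Bool} {R : Word V} {b c : V × Bool} (hb : b ∈ R)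
    (hc : c ∈ R) (hpb : p b) (hpc : ¬ p c)
    (h : ∀ a ∈ R, ∀ d ∈ R, p a → ¬ p d → Γ.Adj a.1 d.1) : HasStarCover Γ 2 R := by
  have hpos : InStar Γ (R.filter p) := by
    refine ⟨c.1, fun a ha => Or.inr ?_⟩
    obtain ⟨haR, ha⟩ := List.mem_filter.1 ha
    exact (h a haR c hc ha hpc).symm
  have hneg : InStar Γ (R.filter fun a => !p a) := by
    refine ⟨b.1, fun a ha => Or.inr ?_⟩
    obtain ⟨haR, ha⟩ := List.mem_filter.1 ha
    exact h b hb a haR hpb (by simpa using ha)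
  exact ((HasStarCover.of_inStar hpos).append (HasStarCover.of_inStar hneg)).of_traceEquiv
    (traceEquiv_filter_append_filter_not h).symm

theorem inStar_of_commute {R : Word V} {z : RAAG Γ} (hz : z ≠ 1)
    (h : ∀ b ∈ R, Commute z (gen Γ b.1)) : InStar Γ R := by
  obtain ⟨W, rfl, hW⟩ := exists_geodesic z
  cases W with
  | nil => exact absurd rfl hz
  | cons y W =>
    refine ⟨y.1, fun b hb => ?_⟩
    have hy := (isReduced_of_length_eq hW).mem_star_of_commute (h b hb).symm y List.mem_cons_self
    exact hy.imp Eq.symm SimpleGraph.Adj.symm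

/-! ### Counting letters and powers of words -/

open scoped Classical in
/-- The number of letters of a word, of either sign, that belong to a vertex. -/
noncomputable def vcount (W : Word V) (x : V) : ℕ := W.countP fun b => b.1 = x

section vcount

variable {U W W' : Word V} {x : V}

@[simp] theorem vcount_nil : vcount ([] : Word V) x = 0 := rfl

@[simp] theorem vcount_append : vcount (U ++ W) x = vcount U x + vcount W x := by simp [vcount]

theorem vcount_cons (a : V × Bool) : vcount (a :: W) x = vcount [a] x + vcount W x :=
  vcount_append (U := [a])

theorem vcount_singleton_self (a : V × Bool) : vcount [a] a.1 = 1 := by simp [vcount]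

theorem vcount_singleton_of_ne {a : V × Bool} (h : a.1 ≠ x) : vcount [a] x = 0 := by
  simp [vcount, h]

@[simp] theorem vcount_reverse : vcount W.reverse x = vcount W x := by simp [vcount]

theorem TraceEquiv.vcount_eq (h : TraceEquiv Γ W W') (x : V) : vcount W x = vcount W' x :=
  h.perm.countP_eq _

theorem vcount_pos_iff : 0 < vcount W x ↔ ∃ b ∈ W, b.1 = x := by simp [vcount]

theorem vcount_pos_of_mem {b : V × Bool} (h : b ∈ W) : 0 < vcount W b.1 :=
  vcount_pos_iff.2 ⟨b, h, rfl⟩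

theorem vcount_eq_zero_or_of_adj (h : ∀ a ∈ U, ∀ b ∈ W, Γ.Adj a.1 b.1) (x : V) :
    vcount U x = 0 ∨ vcount W x = 0 := by
  by_contra! hne
  obtain ⟨a, ha, hax⟩ := vcount_pos_iff.1 (Nat.pos_of_ne_zero hne.1)
  obtain ⟨b, hb, hbx⟩ := vcount_pos_iff.1 (Nat.pos_of_ne_zero hne.2)
  exact (h a ha b hb).ne (hax.trans hbx.symm)

theorem vcount_eq_min_of_adj {P Q R X Z : Word V} (hX : TraceEquiv Γ X (P ++ Q))
    (hZ : TraceEquiv Γ Z (P ++ R)) (h : ∀ a ∈ Q, ∀ b ∈ R, Γ.Adj a.1 b.1) (x : V) :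
    vcount P x = min (vcount X x) (vcount Z x) := by
  have hXx := hX.vcount_eq x
  have hZx := hZ.vcount_eq x
  rw [vcount_append] at hXx hZx
  rcases vcount_eq_zero_or_of_adj h x with hx | hx <;> omega

end vcount

/-- The concatenation of `n` copies of a word. -/
def wordPow (G : Word V) (n : ℕ) : Word V := (List.replicate n G).flatten

section wordPow

variable (G : Word V) (n : ℕ)

theorem wordPow_succ : wordPow G (n + 1) = G ++ wordPow G n := by
  simp [wordPow, List.replicate_succ]

theorem wordPow_succ' : wordPow G (n + 1) = wordPow G n ++ G := by
  simp [wordPow, List.replicate_succ']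

theorem wordVal_wordPow : wordVal Γ (wordPow G n) = wordVal Γ G ^ n := by
  induction n with
  | zero => simp [wordPow]
  | succ n ih => rw [wordPow_succ, wordVal_append, ih, pow_succ']

@[simp] theorem vcount_wordPow (x : V) : vcount (wordPow G n) x = n * vcount G x := by
  induction n with
  | zero => simp [wordPow]
  | succ n ih => rw [wordPow_succ, vcount_append, ih, Nat.succ_mul, add_comm]

theorem length_wordPow : (wordPow G n).length = n * G.length := by simp [wordPow]

theorem reverse_wordPow : (wordPow G n).reverse = wordPow G.reverse n := by
  simp [wordPow, List.reverse_flatten]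

end wordPow

/-! ### Cutting two periodic factorizations of the same word -/

section periodic

variable {A' C A G B : Word V} {n k k' l : ℕ}

theorem exists_prefix_shift {P R : Word V} (h : TraceEquiv Γ (wordPow G n) (P ++ R)) :
    ∃ P' Q' R', TraceEquiv Γ (wordPow G n) (P' ++ R') ∧ TraceEquiv Γ (G ++ P) (P' ++ Q') ∧
      (∀ a ∈ R', ∃ b ∈ R, b.1 = a.1) ∧
      ∀ y, vcount P' y = min (vcount G y + vcount P y) (n * vcount G y) := by
  have hshift : TraceEquiv Γ ((G ++ P) ++ R) (wordPow G n ++ G) := by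
    rw [← wordPow_succ', wordPow_succ, List.append_assoc]
    exact h.symm.append_left G
  obtain ⟨P', Q', R', -, hGP, -, hpow, -, hadj⟩ := hshift.exists_levi
  have hcount : ∀ y, vcount P' y = min (vcount G y + vcount P y) (n * vcount G y) := fun y => by
    simpa only [vcount_append, vcount_wordPow] using vcount_eq_min_of_adj hGP hpow hadj y
  refine ⟨P', Q', R', hpow, hGP, fun a ha => vcount_pos_iff.1 ?_, hcount⟩
  have := vcount_pos_of_mem ha
  have := hcount a.1
  have := h.vcount_eq a.1
  have := hpow.vcount_eq a.1
  simp only [vcount_append, vcount_wordPow] at *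
  omega

/-- The prefix is the union of `A'`, `A` and the translate of `A'` by one period. -/
theorem exists_prefix_of_periodic (h : TraceEquiv Γ (A' ++ C) (A ++ wordPow G n ++ B))
    (hA' : HasStarCover Γ k' A') (hA : HasStarCover Γ k A) (hG : HasStarCover Γ l G) :
    ∃ X Y, TraceEquiv Γ (A ++ wordPow G n ++ B) (X ++ Y) ∧ HasStarCover Γ (k + l + k') X ∧
      ∀ y, max (vcount A' y) (vcount A y) ≤ vcount X y ∧
        min (max (vcount A' y) (vcount A y) + vcount G y) (vcount A y + n * vcount G y) ≤
          vcount X y := by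
  rw [List.append_assoc] at h ⊢
  obtain ⟨P, Q, R, S, hPQ, -, hPR, hQS, hQR⟩ := h.exists_levi
  obtain ⟨P₁, Q₁, R₁, S₁, hQ, -, hpow₁, hB, hQR₁⟩ := hQS.symm.exists_levi
  obtain ⟨P₂, Q₂, R₂, hpow₂, hGP₁, hR₂, hP₂⟩ := exists_prefix_shift hpow₁
  have hcount : ∀ y, vcount P y = min (vcount A' y) (vcount A y) ∧
      vcount A' y = vcount P y + vcount Q y ∧ vcount Q y = vcount P₁ y + vcount Q₁ y ∧
      n * vcount G y = vcount P₁ y + vcount R₁ y ∧ n * vcount G y = vcount P₂ y + vcount R₂ y :=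
    fun y => ⟨vcount_eq_min_of_adj hPQ hPR hQR y, by simpa using hPQ.vcount_eq y,
      by simpa using hQ.vcount_eq y, by simpa using hpow₁.vcount_eq y,
      by simpa using hpow₂.vcount_eq y⟩
  have hadj : ∀ a ∈ R₂, ∀ b ∈ Q₁, Γ.Adj a.1 b.1 := fun a ha b hb => by
    obtain ⟨c, hc, hca⟩ := hR₂ a ha
    exact hca ▸ (hQR₁ b hb c hc).symm
  refine ⟨A ++ (P₂ ++ Q₁), R₂ ++ S₁, ?_, ?_, fun y => ?_⟩
  · have hmid : TraceEquiv Γ (wordPow G n ++ B) (P₂ ++ (R₂ ++ Q₁) ++ S₁) := by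
      simpa using (hpow₂.append_right B).trans (hB.append_left (P₂ ++ R₂))
    simpa using (hmid.trans
      (((TraceEquiv.append_comm_of_adj hadj).append_left P₂).append_right S₁)).append_left A
  · have hP₁Q₁ : HasStarCover Γ k' (P₁ ++ Q₁) :=
      ((hA'.of_traceEquiv hPQ).sublist (List.sublist_append_right P Q)).of_traceEquiv hQ
    have hGA' : HasStarCover Γ (l + k') (P₂ ++ Q₂ ++ Q₁) :=
      (hG.append hP₁Q₁).of_traceEquiv (by simpa using hGP₁.append_right Q₁)
    rw [add_assoc]
    exact hA.append (hGA'.sublist ((List.sublist_append_left P₂ Q₂).append_right Q₁))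
  · have := hcount y
    have := hP₂ y
    simp only [vcount_append]
    omega

theorem exists_suffix_of_periodic {B' : Word V}
    (h : TraceEquiv Γ (C ++ B') (A ++ wordPow G n ++ B))
    (hB' : HasStarCover Γ k' B') (hB : HasStarCover Γ k B) (hG : HasStarCover Γ l G) :
    ∃ Z E, TraceEquiv Γ (A ++ wordPow G n ++ B) (Z ++ E) ∧ HasStarCover Γ (k + l + k') E ∧
      ∀ y, max (vcount B' y) (vcount B y) ≤ vcount E y ∧
        min (max (vcount B' y) (vcount B y) + vcount G y) (vcount B y + n * vcount G y) ≤
          vcount E y := by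
  have hrev : TraceEquiv Γ (B'.reverse ++ C.reverse)
      (B.reverse ++ wordPow G.reverse n ++ A.reverse) := by
    simpa [reverse_wordPow] using h.reverse
  obtain ⟨E, Z, hEZ, hE, hcount⟩ :=
    exists_prefix_of_periodic hrev hB'.reverse hB.reverse hG.reverse
  refine ⟨Z.reverse, E.reverse, ?_, hE.reverse, by simpa using hcount⟩
  simpa [← reverse_wordPow] using hEZ.reverse

theorem exists_middle_of_periodic {A₁ G₁ B₁ A₂ G₂ B₂ : Word V} {n₁ n₂ a₁ g₁ b₁ a₂ g₂ b₂ : ℕ}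
    (h : TraceEquiv Γ (A₁ ++ wordPow G₁ n₁ ++ B₁) (A₂ ++ wordPow G₂ n₂ ++ B₂))
    (hA₁ : HasStarCover Γ a₁ A₁) (hG₁ : HasStarCover Γ g₁ G₁) (hB₁ : HasStarCover Γ b₁ B₁)
    (hA₂ : HasStarCover Γ a₂ A₂) (hG₂ : HasStarCover Γ g₂ G₂) (hB₂ : HasStarCover Γ b₂ B₂) :
    ∃ X R S, TraceEquiv Γ (A₁ ++ wordPow G₁ n₁ ++ B₁) (X ++ R ++ S) ∧
      HasStarCover Γ (a₂ + g₂ + a₁) X ∧ HasStarCover Γ (b₁ + g₁ + b₂) S ∧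
      ∀ b ∈ R, max (vcount A₁ b.1) (vcount A₂ b.1) + vcount G₂ b.1 ≤ vcount X b.1 ∧
        vcount X b.1 + vcount R b.1 + vcount G₁ b.1 ≤
          min (vcount A₁ b.1 + n₁ * vcount G₁ b.1) (vcount A₂ b.1 + n₂ * vcount G₂ b.1) := by
  obtain ⟨X, Y, hXY, hX, hXcount⟩ :=
    exists_prefix_of_periodic (by simpa only [List.append_assoc] using h) hA₁ hA₂ hG₂
  obtain ⟨Z, E, hZE, hE, hEcount⟩ := exists_suffix_of_periodic h.symm hB₂ hB₁ hG₁
  obtain ⟨P, Q, R, S, -, hRS, -, hQS, hadj⟩ := (hXY.symm.trans (h.symm.trans hZE)).exists_levi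
  refine ⟨X, R, S, ?_, hX, (hE.of_traceEquiv hQS).sublist (List.sublist_append_right Q S),
    fun b hb => ?_⟩
  · simpa only [List.append_assoc] using (h.trans hXY).trans (hRS.append_left X)
  · have hR := vcount_pos_of_mem hb
    have hQ := (vcount_eq_zero_or_of_adj hadj b.1).resolve_right hR.ne'
    have hEb := hQS.vcount_eq b.1
    have hYb := hRS.vcount_eq b.1
    have hWb := h.vcount_eq b.1
    have hXYb := hXY.vcount_eq b.1
    have := hXcount b.1
    have := hEcount b.1
    simp only [vcount_append, vcount_wordPow] at hEb hYb hWb hXYb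
    omega

end periodic

/-! ### Walls and periods -/

/-- The part of a word before its `i`-th letter of vertex `y`, where the letters of `y` are numbered
from `0`; the whole word if there are at most `i` of them. -/
noncomputable def before (y : V) : ℕ → Word V → Word V
  | _, [] => []
  | i, a :: W => if vcount [a] y ≤ i then a :: before y (i - vcount [a] y) W else []

section before

variable {U W W' : Word V} {a : V × Bool} {x y : V} {i : ℕ}

theorem before_cons_of_lt (h : i < vcount [a] y) : before y i (a :: W) = [] := by
  simp [before, h]

@[simp] theorem before_cons_add (a : V × Bool) (i : ℕ) (W : Word V) :
    before y (vcount [a] y + i) (a :: W) = a :: before y i W := by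
  simp [before]

theorem before_append_add (U W : Word V) (y : V) (i : ℕ) :
    before y (vcount U y + i) (U ++ W) = U ++ before y i W := by
  induction U with
  | nil => simp
  | cons a U ih => rw [vcount_cons, add_assoc, List.cons_append, before_cons_add, ih,
      List.cons_append]

theorem before_append_of_lt (h : i < vcount U y) : before y i (U ++ W) = before y i U := by
  induction U generalizing i with
  | nil => simp at h
  | cons a U ih =>
    rcases lt_or_ge i (vcount [a] y) with hi | hi
    · simp [before_cons_of_lt hi]
    · obtain ⟨j, rfl⟩ := Nat.exists_eq_add_of_le hi
      rw [vcount_cons (W := U), add_lt_add_iff_left] at h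
      simp [ih h]

theorem TraceEquiv.apply_before_eq {α : Type*} {f : Word V → α}
    (hf : ∀ {U U'}, TraceEquiv Γ U U' → f U = f U')
    (hcons : ∀ a {U U'}, f U = f U' → f (a :: U) = f (a :: U'))
    (hadj : ∀ a : V × Bool, Γ.Adj a.1 y → f [a] = f [])
    (h : TraceEquiv Γ W W') (i : ℕ) : f (before y i W) = f (before y i W') := by
  induction h generalizing i with
  | nil => rfl
  | cons a _ ih =>
    rcases lt_or_ge i (vcount [a] y) with hi | hi
    · rw [before_cons_of_lt hi, before_cons_of_lt hi]
    · obtain ⟨j, rfl⟩ := Nat.exists_eq_add_of_le hi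
      simpa only [before_cons_add] using hcons a (ih j)
  | swap a b W hab =>
    rcases le_or_gt (vcount [a] y + vcount [b] y) i with hi | hi
    · obtain ⟨j, rfl⟩ := Nat.exists_eq_add_of_le hi
      have hba : vcount [a] y + vcount [b] y + j = vcount [b] y + (vcount [a] y + j) := by ring
      rw [add_assoc, before_cons_add, before_cons_add, ← add_assoc, hba, before_cons_add,
        before_cons_add]
      exact hf (swap a b _ hab)
    · have before_swap : ∀ {c d : V × Bool}, c.1 = y → Γ.Adj c.1 d.1 → i < vcount [c] y →
          f (before y i (c :: d :: W)) = f (before y i (d :: c :: W)) := by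
        rintro c d rfl hcd hi
        have hd := before_cons_add (y := c.1) d i (c :: W)
        rw [vcount_singleton_of_ne hcd.ne', zero_add, before_cons_of_lt hi] at hd
        rw [hd, before_cons_of_lt hi, hadj d hcd.symm]
      by_cases ha : a.1 = y
      · have hb := vcount_singleton_of_ne (ha ▸ hab.ne')
        exact before_swap ha hab (by omega)
      · rw [vcount_singleton_of_ne ha, zero_add] at hi
        obtain ⟨c, hc, hcy⟩ := vcount_pos_iff.1 (pos_of_gt hi)
        exact (before_swap (List.mem_singleton.1 hc ▸ hcy) hab.symm hi).symm
  | trans _ _ ih ih' => exact (ih i).trans (ih' i)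

theorem TraceEquiv.vcount_before_eq (h : TraceEquiv Γ W W') (hxy : ¬ Γ.Adj x y) (i : ℕ) :
    vcount (before y i W) x = vcount (before y i W') x := by
  refine h.apply_before_eq (f := fun U => vcount U x) (fun h => h.vcount_eq x)
    (fun a U U' h => ?_) (fun a ha => ?_) i
  · exact (vcount_cons a).trans ((congrArg (vcount [a] x + ·) h).trans (vcount_cons a).symm)
  · exact vcount_singleton_of_ne fun hax => hxy (hax ▸ ha)

end before

/-- The wall crossed by the `i`-th letter of vertex `y` along a word, encoded by the conjugate of
`y` that generates its stabilizer. -/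
noncomputable def wall (Γ : SimpleGraph V) (y : V) (i : ℕ) (W : Word V) : RAAG Γ :=
  MulAut.conj (wordVal Γ (before y i W)) (gen Γ y)

theorem TraceEquiv.wall_eq {W W' : Word V} (h : TraceEquiv Γ W W') (y : V) (i : ℕ) :
    wall Γ y i W = wall Γ y i W' := by
  refine h.apply_before_eq (f := fun U => MulAut.conj (wordVal Γ U) (gen Γ y))
    (fun h => by rw [h.wordVal_eq]) (fun a U U' h => ?_) (fun a ha => ?_) i
  · simp only [wordVal_cons, map_mul, MulAut.mul_apply, h]
  · have hcomm := commute_letterVal_iff.2 (commute_gen_of_adj ha).symm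
    change MulAut.conj (wordVal Γ [a]) (gen Γ y) = MulAut.conj (wordVal Γ []) (gen Γ y)
    rw [wordVal_cons, wordVal_nil, mul_one, map_one, MulAut.one_apply, MulAut.conj_apply,
      ← hcomm.eq, mul_inv_cancel_right]

/-- On the windows `s y ≤ j < e y` of positions, the walls of the word `W` are periodic: conjugation
by `g` shifts the walls of each vertex `y` by `p y` positions, and meanwhile `p x` letters of each
vertex `x` not adjacent to `y` are passed. -/
structure IsPeriodOn (Γ : SimpleGraph V) (W : Word V) (s e : V → ℕ) (g : RAAG Γ) (p : V → ℕ) :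
    Prop where
  pos : ∀ y, s y < e y → 0 < p y
  wall_add : ∀ y j, s y ≤ j → j + p y < e y →
    wall Γ y (j + p y) W = MulAut.conj g (wall Γ y j W)
  vcount_add : ∀ x y j, ¬ Γ.Adj x y → s y ≤ j → j + p y < e y →
    vcount (before y (j + p y) W) x = vcount (before y j W) x + p x

theorem IsPeriodOn.of_traceEquiv {W W' : Word V} {s e p : V → ℕ} {g : RAAG Γ}
    (hg : IsPeriodOn Γ W s e g p) (h : TraceEquiv Γ W W') : IsPeriodOn Γ W' s e g p where
  pos := hg.pos
  wall_add y j hj hj' := by simpa only [h.wall_eq] using hg.wall_add y j hj hj'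
  vcount_add x y j hxy hj hj' := by
    simpa only [h.vcount_before_eq hxy] using hg.vcount_add x y j hxy hj hj'

theorem IsPeriodOn.mono {W : Word V} {s e s' e' p : V → ℕ} {g : RAAG Γ}
    (hg : IsPeriodOn Γ W s e g p) (hs : ∀ y, s y ≤ s' y) (he : ∀ y, e' y ≤ e y) :
    IsPeriodOn Γ W s' e' g p where
  pos y hy := hg.pos y (((hs y).trans_lt hy).trans_le (he y))
  wall_add y j hj hj' := hg.wall_add y j ((hs y).trans hj) (hj'.trans_le (he y))
  vcount_add x y j hxy hj hj' :=
    hg.vcount_add x y j hxy ((hs y).trans hj) (hj'.trans_le (he y))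

theorem exists_before_wordPow {A G : Word V} {n j : ℕ} {y : V} (B : Word V) (hj : vcount A y ≤ j)
    (hj' : j + vcount G y < vcount A y + n * vcount G y) :
    ∃ U, before y j (A ++ wordPow G n ++ B) = A ++ U ∧
      before y (j + vcount G y) (A ++ wordPow G n ++ B) = A ++ (G ++ U) := by
  obtain ⟨i, rfl⟩ := Nat.exists_eq_add_of_le hj
  cases n with
  | zero => omega
  | succ n =>
    have hi : i < vcount (wordPow G n) y := by
      rw [vcount_wordPow]
      rw [Nat.succ_mul] at hj'
      omega
    refine ⟨before y i (wordPow G n), ?_, ?_⟩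
    · rw [List.append_assoc, before_append_add, wordPow_succ', List.append_assoc,
        before_append_of_lt hi]
    · rw [List.append_assoc, add_assoc, before_append_add, wordPow_succ, List.append_assoc,
        add_comm i, before_append_add, before_append_of_lt hi]

theorem isPeriodOn_append_wordPow_append (A G B : Word V) (n : ℕ) :
    IsPeriodOn Γ (A ++ wordPow G n ++ B) (vcount A) (fun y => vcount A y + n * vcount G y)
      (MulAut.conj (wordVal Γ A) (wordVal Γ G)) (vcount G) where
  pos y hy := Nat.pos_of_ne_zero fun h => by simp [h] at hy
  wall_add y j hj hj' := by
    obtain ⟨U, hU, hU'⟩ := exists_before_wordPow B hj hj'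
    simp only [wall, hU, hU', wordVal_append, MulAut.conj_apply]
    group
  vcount_add x y j _ hj hj' := by
    obtain ⟨U, hU, hU'⟩ := exists_before_wordPow B hj hj'
    simp only [hU, hU', vcount_append]
    ring

/-! ### Two periods on a word that is not covered by two stars -/

section middle

variable {X R E : Word V} {u v z : RAAG Γ} {s e p q : V → ℕ} {m n : ℕ}

theorem commute_of_commute_wall
    (h : ∀ b ∈ R, ∀ j, vcount X b.1 ≤ j → j < vcount X b.1 + vcount R b.1 →
      Commute z (wall Γ b.1 j (X ++ R ++ E))) :
    ∀ b ∈ R, Commute (MulAut.conj (wordVal Γ X)⁻¹ z) (gen Γ b.1) := by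
  induction R generalizing X with
  | nil => simp
  | cons c R ih =>
    have hc : Commute (MulAut.conj (wordVal Γ X)⁻¹ z) (gen Γ c.1) := by
      have hbefore : before c.1 (vcount X c.1) (X ++ (c :: R) ++ E) = X := by
        have hzero := before_append_add X (c :: R ++ E) c.1 0
        rwa [List.cons_append, before_cons_of_lt (by simp [vcount_singleton_self]), add_zero,
          List.append_nil, ← List.cons_append, ← List.append_assoc] at hzero
      have hwall := h c List.mem_cons_self _ le_rfl
        (Nat.lt_add_of_pos_right (vcount_pos_of_mem List.mem_cons_self))
      rw [wall, hbefore] at hwall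
      simpa [mul_assoc] using hwall.map (MulAut.conj (wordVal Γ X)⁻¹)
    have hX : MulAut.conj (wordVal Γ (X ++ [c]))⁻¹ z = MulAut.conj (wordVal Γ X)⁻¹ z := by
      have hcomm := (commute_letterVal_iff.2 hc).eq
      simp only [MulAut.conj_apply, inv_inv, wordVal_append, wordVal_cons, wordVal_nil, mul_one]
        at hcomm ⊢
      rw [mul_inv_rev, mul_assoc, mul_assoc, inv_mul_eq_iff_eq_mul, ← hcomm]
      simp only [mul_assoc]
    refine List.forall_mem_cons.2 ⟨hc, fun b hb => hX ▸ ih (X := X ++ [c]) ?_ b hb⟩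
    intro b hb j hj hj'
    rw [vcount_append] at hj hj'
    simpa using h b (List.mem_cons_of_mem c hb) j (by omega) (by rw [vcount_cons]; omega)

theorem eq_of_conj_wall_eq (hR : ¬ InStar Γ R)
    (h : ∀ b ∈ R, ∀ j, vcount X b.1 ≤ j → j < vcount X b.1 + vcount R b.1 →
      MulAut.conj u (wall Γ b.1 j (X ++ R ++ E)) = MulAut.conj v (wall Γ b.1 j (X ++ R ++ E))) :
    u = v := by
  by_contra huv
  refine hR (inStar_of_commute (z := MulAut.conj (wordVal Γ X)⁻¹ (v⁻¹ * u)) ?_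
    (commute_of_commute_wall fun b hb j hj hj' => conj_apply_eq_conj_apply_iff.1 (h b hb j hj hj')))
  rwa [Ne, map_eq_one_iff _ (MulEquiv.injective _), inv_mul_eq_one, eq_comm]

namespace IsPeriodOn

variable (hu : IsPeriodOn Γ (X ++ R ++ E) s e u p) (hv : IsPeriodOn Γ (X ++ R ++ E) s e v q)
  (hwindow : ∀ b ∈ R, s b.1 + q b.1 ≤ vcount X b.1 ∧
    vcount X b.1 + vcount R b.1 + p b.1 ≤ e b.1)
include hu hv hwindow

theorem commute (hR : ¬ InStar Γ R) : Commute u v := by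
  suffices h : u = v * u * v⁻¹ from eq_mul_inv_iff_mul_eq.1 h
  refine eq_of_conj_wall_eq (X := X) (E := E) hR fun b hb j hj hj' => ?_
  obtain ⟨hs, he⟩ := hwindow b hb
  obtain ⟨i, rfl⟩ : ∃ i, j = i + q b.1 := ⟨j - q b.1, by omega⟩
  have hwall := hv.wall_add b.1 i (by omega) (by omega)
  calc MulAut.conj u (wall Γ b.1 (i + q b.1) (X ++ R ++ E))
      = wall Γ b.1 (i + p b.1 + q b.1) (X ++ R ++ E) := by
        rw [add_right_comm, hu.wall_add _ _ (by omega) (by omega)]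
    _ = MulAut.conj v (MulAut.conj u (wall Γ b.1 i (X ++ R ++ E))) := by
        rw [hv.wall_add _ _ (by omega) (by omega), hu.wall_add _ _ (by omega) (by omega)]
    _ = MulAut.conj (v * u * v⁻¹) (wall Γ b.1 (i + q b.1) (X ++ R ++ E)) := by
        rw [hwall]
        simp only [← MulAut.mul_apply, ← map_mul, inv_mul_cancel_right]

theorem mul_eq_mul_of_not_adj {b : V × Bool} (hb : b ∈ R) {x : V} (hx : ¬ Γ.Adj x b.1) :
    q b.1 * p x = p b.1 * q x := by
  obtain ⟨hs, he⟩ := hwindow b hb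
  have hpos := vcount_pos_of_mem hb
  have heq := iterate_eq_iterate_of_periodic (a := (· + p x)) (b := (· + q x))
    (T := fun j => vcount (before b.1 j (X ++ R ++ E)) x) (s := s b.1) (e := e b.1) (p := p b.1)
    (q := q b.1) (fun _ => Nat.add_right_comm _ _ _) (fun j => hu.vcount_add x b.1 j hx)
    (fun j => hv.vcount_add x b.1 j hx) (by omega) (j := s b.1) (k := s b.1) (m := q b.1)
    (n := p b.1) le_rfl (by omega) le_rfl (by omega) (by rw [mul_comm])
  simpa using heq

theorem mul_eq_mul_of_not_hasStarCover (hR : ¬ HasStarCover Γ 2 R) :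
    ∀ b ∈ R, ∀ c ∈ R, q b.1 * p c.1 = p b.1 * q c.1 := by
  classical
  intro b hb c hc
  by_contra hbc
  refine hR (hasStarCover_two_of_adj (p := fun x => decide (q b.1 * p x.1 = p b.1 * q x.1)) hb hc
    (by simpa using mul_comm _ _) (by simpa using hbc) fun x hx y _ hpx hpy => ?_)
  by_contra hxy
  obtain ⟨hs, he⟩ := hwindow x hx
  have hpos : 0 < p x.1 := hu.pos x.1 (by have := vcount_pos_of_mem hx; omega)
  have hratio := hu.mul_eq_mul_of_not_adj hv hwindow hx (x := y.1) fun h => hxy h.symm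
  simp only [decide_eq_true_eq] at hpx hpy
  refine hpy (Nat.eq_of_mul_eq_mul_left hpos ?_)
  linear_combination (exp := 1) p y.1 * hpx + p b.1 * hratio

theorem pow_eq_pow (hR : ¬ InStar Γ R) (hmn : ∀ b ∈ R, m * p b.1 = n * q b.1) :
    u ^ m = v ^ n := by
  have hcomm := hu.commute hv hwindow hR
  refine eq_of_conj_wall_eq (X := X) (E := E) hR fun b hb j hj hj' => ?_
  obtain ⟨hs, he⟩ := hwindow b hb
  have hconj : Function.Commute (MulAut.conj u) (MulAut.conj v) := fun t => by
    simp only [← MulAut.mul_apply, ← map_mul, hcomm.eq]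
  have heq := iterate_eq_iterate_of_periodic (T := fun j => wall Γ b.1 j (X ++ R ++ E)) hconj
    (hu.wall_add b.1) (hv.wall_add b.1) (by omega) (j := j) (k := j) (by omega) (by omega)
    (by omega) (by omega) (congrArg (j + ·) (hmn b hb))
  simpa only [iterate_conj_apply] using heq

theorem exists_eq_pow (hR : ∀ k ≤ 2, ¬ HasStarCover Γ k R) : ∃ k m n, u = k ^ m ∧ v = k ^ n := by
  obtain ⟨c, hc⟩ : ∃ c, c ∈ R :=
    List.exists_mem_of_ne_nil R fun h => hR 0 (by norm_num) (h ▸ HasStarCover.nil)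
  have hstar : ¬ InStar Γ R := fun h => hR 1 (by norm_num) (HasStarCover.of_inStar h)
  obtain ⟨hs, he⟩ := hwindow c hc
  have hpos : 0 < p c.1 := hu.pos c.1 (by have := vcount_pos_of_mem hc; omega)
  obtain ⟨d, m, n, hd, hmn, hm, hn⟩ := Nat.exists_coprime' (Nat.gcd_pos_of_pos_right (q c.1) hpos)
  have hpow : u ^ m = v ^ n := hu.pow_eq_pow hv hwindow hstar fun b hb => by
    have := hu.mul_eq_mul_of_not_hasStarCover hv hwindow (hR 2 le_rfl) c hc b hb
    refine Nat.eq_of_mul_eq_mul_right hd ?_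
    rw [hm, hn] at this
    linear_combination this
  obtain ⟨k, hk, hk'⟩ :=
    exists_eq_pow_of_commute_of_coprime (hu.commute hv hwindow hstar) hmn hpow
  exact ⟨k, n, m, hk, hk'⟩

end IsPeriodOn

end middle

/-! ### Primitive quasi-roots -/

theorem IsPrimitive.eq_one_of_eq_pow {g k : RAAG Γ} {n : ℕ} (hg : IsPrimitive g) (h : g = k ^ n) :
    n = 1 := by
  rcases n with _ | _ | n
  · exact absurd (by simpa using h) hg.1
  · rfl
  · exact absurd h (hg.2 k _ (by omega))

theorem IsPrimitive.map {V' : Type*} {Γ' : SimpleGraph V'} {g : RAAG Γ} (hg : IsPrimitive g)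
    (e : RAAG Γ ≃* RAAG Γ') : IsPrimitive (e g) := by
  refine ⟨by simpa using hg.1, fun k n hn h => hg.2 (e.symm k) n hn ?_⟩
  rw [← map_pow, ← h, e.symm_apply_apply]

theorem conj_eq_conj_of_periodic {A₁ G₁ B₁ A₂ G₂ B₂ : Word V} {n₁ n₂ a₁ g₁ b₁ a₂ g₂ b₂ : ℕ}
    (h : TraceEquiv Γ (A₁ ++ wordPow G₁ n₁ ++ B₁) (A₂ ++ wordPow G₂ n₂ ++ B₂))
    (hA₁ : HasStarCover Γ a₁ A₁) (hG₁ : HasStarCover Γ g₁ G₁) (hB₁ : HasStarCover Γ b₁ B₁)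
    (hA₂ : HasStarCover Γ a₂ A₂) (hG₂ : HasStarCover Γ g₂ G₂) (hB₂ : HasStarCover Γ b₂ B₂)
    (hprim₁ : IsPrimitive (wordVal Γ G₁)) (hprim₂ : IsPrimitive (wordVal Γ G₂))
    (hstar : a₁ + a₂ + g₁ + g₂ + b₁ + b₂ + 2 < starLength (wordVal Γ (A₁ ++ wordPow G₁ n₁ ++ B₁))) :
    MulAut.conj (wordVal Γ A₁) (wordVal Γ G₁) = MulAut.conj (wordVal Γ A₂) (wordVal Γ G₂) := by
  obtain ⟨X, R, S, hXRS, hX, hS, hwindow⟩ :=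
    exists_middle_of_periodic h hA₁ hG₁ hB₁ hA₂ hG₂ hB₂
  have hR : ∀ k ≤ 2, ¬ HasStarCover Γ k R := fun k hk hR => by
    have := (((hX.append hR).append hS).of_traceEquiv hXRS.symm).starLength_le
    omega
  have hperiod₁ := ((isPeriodOn_append_wordPow_append A₁ G₁ B₁ n₁).of_traceEquiv hXRS).mono
    (fun y => le_max_left _ (vcount A₂ y))
    fun y => min_le_left _ (vcount A₂ y + n₂ * vcount G₂ y)
  have hperiod₂ := ((isPeriodOn_append_wordPow_append A₂ G₂ B₂ n₂).of_traceEquiv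
    (h.symm.trans hXRS)).mono (fun y => le_max_right (vcount A₁ y) _)
    fun y => min_le_right (vcount A₁ y + n₁ * vcount G₁ y) _
  obtain ⟨k, m, n, hm, hn⟩ := hperiod₁.exists_eq_pow hperiod₂ hwindow hR
  obtain rfl := (hprim₁.map _).eq_one_of_eq_pow hm
  obtain rfl := (hprim₂.map _).eq_one_of_eq_pow hn
  exact hm.trans hn.symm

namespace IsQuasiRootDecomp

variable {h a g b a₁ g₁ b₁ a₂ g₂ b₂ : RAAG Γ} {n n₁ n₂ : ℕ}

theorem exists_isReduced (hd : IsQuasiRootDecomp h a g b n) :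
    ∃ A G B, IsReduced Γ A ∧ IsReduced Γ G ∧ IsReduced Γ B ∧ wordVal Γ A = a ∧ wordVal Γ G = g ∧
      wordVal Γ B = b ∧ IsReduced Γ (A ++ wordPow G n ++ B) ∧
      wordVal Γ (A ++ wordPow G n ++ B) = h := by
  obtain ⟨A, rfl, hA⟩ := exists_geodesic a
  obtain ⟨G, rfl, hG⟩ := exists_geodesic g
  obtain ⟨B, rfl, hB⟩ := exists_geodesic b
  have hval : wordVal Γ (A ++ wordPow G n ++ B) = h := by
    simp only [hd.eq_mul, wordVal_append, wordVal_wordPow]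
  refine ⟨A, G, B, isReduced_of_length_eq hA, isReduced_of_length_eq hG, isReduced_of_length_eq hB,
    rfl, rfl, rfl, isReduced_of_length_eq ?_, hval⟩
  rw [hval, hd.length_eq, ← hA, ← hG, ← hB, List.length_append, List.length_append, length_wordPow]
  ring

theorem conj_eq (h₁ : IsQuasiRootDecomp h a₁ g₁ b₁ n₁) (h₂ : IsQuasiRootDecomp h a₂ g₂ b₂ n₂)
    (hg₁ : IsPrimitive g₁) (hg₂ : IsPrimitive g₂)
    (hstar : starLength a₁ + starLength a₂ + starLength g₁ + starLength g₂ + starLength b₁ +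
      starLength b₂ + 2 < starLength h) :
    a₁ * g₁ * a₁⁻¹ = a₂ * g₂ * a₂⁻¹ := by
  obtain ⟨A₁, G₁, B₁, hA₁, hG₁, hB₁, rfl, rfl, rfl, hred₁, rfl⟩ := h₁.exists_isReduced
  obtain ⟨A₂, G₂, B₂, hA₂, hG₂, hB₂, rfl, rfl, rfl, hred₂, hval⟩ := h₂.exists_isReduced
  exact conj_eq_conj_of_periodic (hred₁.traceEquiv_of_wordVal_eq hred₂ hval.symm) hA₁.hasStarCover
    hG₁.hasStarCover hB₁.hasStarCover hA₂.hasStarCover hG₂.hasStarCover hB₂.hasStarCover hg₁ hg₂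
    hstar

theorem right_conj_eq (hd : IsQuasiRootDecomp h a g b n) :
    b⁻¹ * g * b = h⁻¹ * (a * g * a⁻¹) * h := by
  rw [hd.eq_mul]
  group

end IsQuasiRootDecomp

theorem IsStarQuasiRootDecomp.conj_eq {A B r : ℝ} {h a₁ g₁ b₁ a₂ g₂ b₂ : RAAG Γ} {n₁ n₂ : ℕ}
    (h₁ : IsStarQuasiRootDecomp A B r h a₁ g₁ b₁ n₁)
    (h₂ : IsStarQuasiRootDecomp A B r h a₂ g₂ b₂ n₂) (hg₁ : IsPrimitive g₁) (hg₂ : IsPrimitive g₂)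
    (hh : 2 * A + 2 * B + 2 * r + 2 < starLength h) : a₁ * g₁ * a₁⁻¹ = a₂ * g₂ * a₂⁻¹ := by
  refine h₁.toIsQuasiRootDecomp.conj_eq h₂.toIsQuasiRootDecomp hg₁ hg₂ ?_
  rify
  linarith [h₁.left_le, h₁.right_le, h₁.root_le, h₂.left_le, h₂.right_le, h₂.root_le]

end RAAG

theorem mainTheorem4_general {V : Type*} (Γ : SimpleGraph V) (h : RAAG Γ) (A B r : ℝ)
    (hh : 2 * A + 2 * B + 2 * r + 2 < (RAAG.starLength h : ℝ)) :
    (∀ g₁ g₂ : RAAG Γ,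
      RAAG.IsPrimitive g₁ → RAAG.IsStarQuasiRoot A B r h g₁ →
      RAAG.IsPrimitive g₂ → RAAG.IsStarQuasiRoot A B r h g₂ →
      IsConj g₁ g₂) ∧
    (∀ (a₁ g₁ b₁ a₂ g₂ b₂ : RAAG Γ) (n₁ n₂ : ℕ),
      RAAG.IsPrimitive g₁ → RAAG.IsStarQuasiRootDecomp A B r h a₁ g₁ b₁ n₁ →
      RAAG.IsPrimitive g₂ → RAAG.IsStarQuasiRootDecomp A B r h a₂ g₂ b₂ n₂ →
      a₁ * g₁ * a₁⁻¹ = a₂ * g₂ * a₂⁻¹ ∧ b₁⁻¹ * g₁ * b₁ = b₂⁻¹ * g₂ * b₂) := by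
  constructor
  · rintro g₁ g₂ hg₁ ⟨a₁, b₁, n₁, h₁⟩ hg₂ ⟨a₂, b₂, n₂, h₂⟩
    exact (isConj_iff.2 ⟨a₁, h₁.conj_eq h₂ hg₁ hg₂ hh⟩).trans (isConj_iff.2 ⟨a₂, rfl⟩).symm
  · intro a₁ g₁ b₁ a₂ g₂ b₂ n₁ n₂ hg₁ h₁ hg₂ h₂
    have hconj := h₁.conj_eq h₂ hg₁ hg₂ hh
    exact ⟨hconj, by rw [h₁.right_conj_eq, h₂.right_conj_eq, hconj]⟩

theorem mainTheorem4 {V : Type*} [Fintype V] (Γ : SimpleGraph V) (h : RAAG Γ) (A B r : ℝ)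
    (hA : 0 ≤ A) (hB : 0 ≤ B) (hr : 1 ≤ r)
    (hh : 2 * A + 2 * B + (2 * (Fintype.card V : ℝ) + 3) * r + 2 ≤ (RAAG.starLength h : ℝ)) :
    (∀ g₁ g₂ : RAAG Γ,
      RAAG.IsPrimitive g₁ → RAAG.IsStarQuasiRoot A B r h g₁ →
      RAAG.IsPrimitive g₂ → RAAG.IsStarQuasiRoot A B r h g₂ →
      IsConj g₁ g₂) ∧
    (∀ (a₁ g₁ b₁ a₂ g₂ b₂ : RAAG Γ) (n₁ n₂ : ℕ),
      RAAG.IsPrimitive g₁ → RAAG.IsStarQuasiRootDecomp A B r h a₁ g₁ b₁ n₁ →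
      RAAG.IsPrimitive g₂ → RAAG.IsStarQuasiRootDecomp A B r h a₂ g₂ b₂ n₂ →
      a₁ * g₁ * a₁⁻¹ = a₂ * g₂ * a₂⁻¹ ∧ b₁⁻¹ * g₁ * b₁ = b₂⁻¹ * g₂ * b₂) :=
  mainTheorem4_general Γ h A B r (by nlinarith [Nat.cast_nonneg (α := ℝ) (Fintype.card V)])
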